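/- Let $V$ be an $n$-dimensional vector space over a field $\mathbb K$. The $3$-Grassmannian $\mathcal G_3(V)$ is the point-line geometry whose points are the $3$-dimensional subspaces of $V$ and whose lines are the sets $\{X : Y\subset X\subset Z,\ \dim X=3\}$, where $Y\subset Z$ are subspaces of $V$ with $\dim Y=2$ and $\dim Z=4$. A subspace of $\mathcal G_3(V)$ is a set $S$ of points such that every line meeting $S$ in at least two distinct points is contained in $S$; a hyperplane of $\mathcal G_3(V)$ is a proper subspace (one not containing all points) that meets every line in at least one point. The upper radical $R^\uparrow(H)$ of a hyperplane $H$ is the set of $2$-dimensional subspaces $A$ of $V$ such that every $3$-dimensional subspace of $V$ containing $A$ belongs to $H$. A line spread of $\mathrm{PG}(V)$ is a set of $2$-dimensional subspaces of $V$ such that every $1$-dimensional subspace of $V$ is contained in exactly one of them. The field $\mathbb K$ is called quadratically closed if every polynomial of degree $2$ over $\mathbb K$ has a root in $\mathbb K$ (equivalently, $\mathbb K$ has no field extension of degree $2$). **Theorem.** (1) If $n=5$, then for every field $\mathbb K$ and every hyperplane $H$ of $\mathcal G_3(V)$, $R^\uparrow(H)\neq\emptyset$. (2) If $n=6$, then there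 exists a hyperplane $H$ of $\mathcal G_3(V)$ such that $R^\uparrow(H)$ is a line spread of $\mathrm{PG}(V)$ if and only if $\mathbb K$ is not quadratically closed. -/

import Mathlib

namespace GrassmannHyperplane

/-- Every polynomial of degree `2` over `K` has a root in `K`
(equivalently, `K` has no field extension of degree `2`; no restriction on the characteristic). -/
def IsQuadraticallyClosed (K : Type*) [Field K] : Prop :=
  ∀ p : Polynomial K, p.natDegree = 2 → ∃ x : K, p.IsRoot x

section
variable (K : Type*) (V : Type*) [Field K] [AddCommGroup V] [Module K V]

/-- The points of the `k`-Grassmannian of `V`: the `k`-dimensional subspaces of `V`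
(used for finite-dimensional `V`). -/
def points (k : ℕ) : Set (Submodule K V) :=
  {X | Module.finrank K X = k}

variable {K V}

/-- The set of `k`-dimensional subspaces lying between `Y` and `Z`. -/
def pencil (k : ℕ) (Y Z : Submodule K V) : Set (Submodule K V) :=
  {X | X ∈ points K V k ∧ Y ≤ X ∧ X ≤ Z}

/-- The lines of the `k`-Grassmannian: the pencils between a `(k-1)`-subspace and a
`(k+1)`-subspace containing it. -/
def IsLine (k : ℕ) (l : Set (Submodule K V)) : Prop :=
  ∃ Y Z : Submodule K V, Y < Z ∧ Module.finrank K Y + 1 = k ∧ Module.finrank K Z = k + 1 ∧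
    l = pencil k Y Z

/-- Subspaces of the point-line geometry: sets of points that contain every line meeting them
in at least two distinct points. -/
def IsGeomSubspace (k : ℕ) (S : Set (Submodule K V)) : Prop :=
  S ⊆ points K V k ∧
    ∀ l : Set (Submodule K V), IsLine k l → (l ∩ S).Nontrivial → l ⊆ S

/-- Hyperplanes of the point-line geometry: proper subspaces meeting every line. -/
def IsHyperplane (k : ℕ) (H : Set (Submodule K V)) : Prop :=
  IsGeomSubspace k H ∧ H ≠ points K V k ∧
    ∀ l : Set (Submodule K V), IsLine k l → (l ∩ H).Nonempty

/-- The upper radical: the `(k-1)`-subspaces all of whose `k`-dimensional overspaces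
belong to `H`. -/
def upperRadical (k : ℕ) (H : Set (Submodule K V)) : Set (Submodule K V) :=
  {A | Module.finrank K A + 1 = k ∧ ∀ X ∈ points K V k, A ≤ X → X ∈ H}

/-- Line spreads of the projective space of `V`: sets of `2`-subspaces such that every
`1`-subspace is contained in exactly one member. -/
def IsLineSpread (S : Set (Submodule K V)) : Prop :=
  S ⊆ points K V 2 ∧ ∀ P ∈ points K V 1, ∃! L : Submodule K V, L ∈ S ∧ P ≤ L

end

end GrassmannHyperplane

/-!
The proof replaces the classification of hyperplanes by alternating forms with a study of residues.
If `B` is a `(k-2)`-subspace and `H` a hyperplane of the `k`-Grassmannian, then "`x` and `y` are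
dependent modulo `B`, or `B + ⟨x, y⟩` belongs to `H`" is a null relation, i.e. a possibly degenerate
null polarity (`IsGeomSubspace.isNullRelation_residueRel`).

In dimension `5`, annihilators turn `H` into a hyperplane of the `2`-Grassmannian of the dual space,
that is, into a null relation on a `5`-dimensional space. The common perp of two related vectors
there has dimension at least `3`, so there is a totally isotropic plane
(`IsNullRelation.exists_isotropic_plane`); its annihilator in `V` lies in the upper radical.

In dimension `6`, let the upper radical be a line spread and let `L`, `M` be two of its members. For
`m` in `M`, the residue at `m` pairs `L` with the `2`-dimensional space `V / (L + M)`. The crucial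
point is that this pairing is given by a bilinear map (`IsNullRelation.exists_pairing`). It rests on
`IsNullRelation.exists_hyperbolic_ratio`, which derives linearity of a null relation from its values
in a `4`-space. For `m₁`, `m₂` spanning `M`, the two pairings are nondegenerate and differ by a
`2 × 2` matrix. Over a quadratically closed field this matrix has an eigenvector, that is, some `l`
in `L` with the same perp relative to `m₁` and to `m₂`. Then some combination `m` of `m₁` and `m₂`
spans with `l` a member of the upper radical. This is impossible, because `⟨l, m⟩` would be a spread
member meeting both `L` and `M`.

Conversely, a quadratic polynomial without root gives a quadratic extension `F` of `K`. Identify `V`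
with `F³` and let `θ : F → K` be a nonzero `K`-linear functional. The `3`-subspaces on which
`θ ∘ det` vanishes form a hyperplane, and `θ(det(·, a, b)) = 0` exactly if `a`, `b` are dependent
over `F`. So the upper radical is the spread of one-dimensional `F`-subspaces
(`isLineSpread_upperRadical_detForm`).
-/

namespace GrassmannHyperplane

/-! ### Null relations -/

section NullRelation

variable {K V : Type*} [Field K] [AddCommGroup V] [Module K V]

/-- A (possibly degenerate) null polarity of the projective space of `V`, as a relation between
vectors: it is reflexive and symmetric, and the set of vectors related to a given one is a subspace
of codimension at most `1` (the last three fields). -/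
structure IsNullRelation (K : Type*) {V : Type*} [Field K] [AddCommGroup V] [Module K V]
    (R : V → V → Prop) : Prop where
  refl : ∀ x, R x x
  symm : ∀ {x y}, R x y → R y x
  add : ∀ {x y z}, R x y → R x z → R x (y + z)
  smul : ∀ (c : K) {x y}, R x y → R x (c • y)
  meet : ∀ x y z, R x z ∨ ∃ s : K, R x (y + s • z)

namespace IsNullRelation

variable {R : V → V → Prop} (hR : IsNullRelation K R)
include hR

/-- The subspace of all vectors related to `x`. -/
def perp (x : V) : Submodule K V where
  carrier := {y | R x y}
  add_mem' := hR.add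
  zero_mem' := by simpa using hR.smul 0 (hR.refl x)
  smul_mem' c _ h := hR.smul c h

theorem mem_perp {x y : V} : y ∈ hR.perp x ↔ R x y := Iff.rfl

theorem mem_perp_comm {x y : V} : y ∈ hR.perp x ↔ x ∈ hR.perp y := ⟨hR.symm, hR.symm⟩

/-- A perp has codimension at most `1`, so nothing lies strictly between it and `⊤`. -/
theorem eq_top_of_perp_le {x v : V} {S : Submodule K V} (hS : hR.perp x ≤ S)
    (hv : v ∉ hR.perp x) (hvS : v ∈ S) : S = ⊤ := by
  refine eq_top_iff.2 fun u _ => ?_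
  obtain h | ⟨s, h⟩ := hR.meet x u v
  · exact absurd h hv
  · simpa using S.sub_mem (hS h) (S.smul_mem s hvS)

theorem mem_perp_smul_add_smul {x y : V} {v : V} (hx : v ∈ hR.perp x) (hy : v ∈ hR.perp y)
    (a b : K) : v ∈ hR.perp (a • x + b • y) :=
  hR.symm (hR.add (hR.smul a (hR.symm hx)) (hR.smul b (hR.symm hy)))

theorem exists_functional {x v : V} (hv : v ∉ hR.perp x) {c : K} (hc : c ≠ 0) :
    ∃ f : V →ₗ[K] K, f v = c ∧ ∀ u, u ∈ hR.perp x ↔ f u = 0 := by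
  obtain ⟨f, hf, hle⟩ := (hR.perp x).exists_le_ker_of_lt_top
    (lt_top_iff_ne_top.2 fun h => hv (h ▸ Submodule.mem_top))
  have key : ∀ u, f u = 0 → u ∈ hR.perp x := fun u hu => by
    by_contra hux
    exact hf (LinearMap.ker_eq_top.1 (hR.eq_top_of_perp_le hle hux hu))
  have hfv : f v ≠ 0 := fun h => hv (key v h)
  refine ⟨(c / f v) • f, by simp [hfv], fun u => ⟨fun h => ?_, fun h => key u ?_⟩⟩
  · have : f u = 0 := hle h
    simp [this]
  · simpa [hc, hfv] using h

theorem finrank_le_finrank_perp_add_one [FiniteDimensional K V] (x : V) :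
    Module.finrank K V ≤ Module.finrank K (hR.perp x) + 1 := by
  by_cases h : ∃ v, v ∉ hR.perp x
  · obtain ⟨v, hv⟩ := h
    have h1 := hR.eq_top_of_perp_le (S := hR.perp x ⊔ Submodule.span K {v}) le_sup_left hv
      (Submodule.mem_sup_right (Submodule.mem_span_singleton_self v))
    have h2 := Submodule.finrank_sup_span_singleton hv
    rw [h1, finrank_top] at h2
    exact h2.le
  · push Not at h
    have : hR.perp x = ⊤ := eq_top_iff.2 fun u _ => h u
    rw [this, finrank_top]
    exact Nat.le_succ _

/-- A line disjoint from the radical meets distinct perps: if the perp of `x` were contained in the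
perp of `y`, a combination of `x` and `y` related to one further vector would be radical. -/
theorem not_perp_le_of_forall_ne_top {x y : V}
    (h : ∀ a b : K, a ≠ 0 ∨ b ≠ 0 → hR.perp (a • x + b • y) ≠ ⊤) : ¬ hR.perp x ≤ hR.perp y := by
  intro hle
  have hx : hR.perp x ≠ ⊤ := by simpa using h 1 0 (by simp)
  obtain ⟨v, hv⟩ : ∃ v, v ∉ hR.perp x := by
    by_contra! hc
    exact hx (eq_top_iff.2 fun u _ => hc u)
  obtain h1 | ⟨s, h1⟩ := hR.meet v y x
  · exact hv (hR.symm h1)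
  · refine h s 1 (by simp) (hR.eq_top_of_perp_le (x := x) (v := v) ?_ hv ?_)
    · intro u hu
      exact hR.mem_perp_smul_add_smul hu (hle hu) s 1
    · rw [add_comm, one_smul]
      exact hR.symm h1

/-- On a hyperbolic quadruple the null relation is linear: the point of the line `y₁ y₂` related to
`x₁ + s x₂` depends on `s` as it does for an alternating form. This is where reflexivity of the
relation rules out arbitrary bijections between the two lines. -/
theorem exists_hyperbolic_ratio {x₁ x₂ y₁ y₂ : V} (h11 : ¬ R x₁ y₁) (h22 : ¬ R x₂ y₂)
    (hx : R x₁ x₂) (h12 : R x₁ y₂) (h21 : R x₂ y₁) (hy : R y₁ y₂) :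
    ∃ γ : K, γ ≠ 0 ∧ ∀ s : K, s ≠ 0 → R (x₁ + s • x₂) (y₁ + (γ / s) • y₂) := by
  have addl : ∀ {x y z : V}, R x z → R y z → R (x + y) z :=
    fun h h' => hR.symm (hR.add (hR.symm h) (hR.symm h'))
  have smull : ∀ (c : K) {x z : V}, R x z → R (c • x) z :=
    fun c _ _ h => hR.symm (hR.smul c (hR.symm h))
  have cancel : ∀ {s : K} {x z : V}, s ≠ 0 → R (s • x) z → R x z := fun {s x z} hs h => by
    simpa [smul_smul, inv_mul_cancel₀ hs] using smull s⁻¹ h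
  have subr : ∀ {x y z : V}, R x (y + z) → R x z → R x y := fun h h' => by
    simpa using hR.add h (hR.smul (-1 : K) h')
  -- `y₁ + g s y₂` is the point of the line `y₁ y₂` related to `x₁ + s x₂`
  have hg : ∀ s : K, s ≠ 0 → ∃ t : K, t ≠ 0 ∧ R (x₁ + s • x₂) (y₁ + t • y₂) := by
    intro s hs
    obtain h | ⟨t, h⟩ := hR.meet (x₁ + s • x₂) y₁ y₂
    · exact absurd (cancel hs (hR.symm (subr (by rw [add_comm]; exact hR.symm h)
        (hR.symm h12)))) h22
    · refine ⟨t, ?_, h⟩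
      rintro rfl
      rw [zero_smul, add_zero] at h
      exact h11 (hR.symm (subr (hR.symm h) (hR.smul s (hR.symm h21))))
  -- `x₁ + k s y₂` is the point of the line `x₁ y₂` related to `y₁ + s x₂`
  have hk : ∀ s : K, s ≠ 0 → ∃ t : K, t ≠ 0 ∧ R (y₁ + s • x₂) (x₁ + t • y₂) := by
    intro s hs
    obtain h | ⟨t, h⟩ := hR.meet (y₁ + s • x₂) x₁ y₂
    · exact absurd (cancel hs (hR.symm (subr (by rw [add_comm]; exact hR.symm h)
        (hR.symm hy)))) h22
    · refine ⟨t, ?_, h⟩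
      rintro rfl
      rw [zero_smul, add_zero] at h
      exact h11 (subr (hR.symm h) (hR.smul s hx))
  -- `y₁ + h s x₂` is the point of the line `y₁ x₂` related to `x₁ + s y₂`
  have hh : ∀ s : K, s ≠ 0 → ∃ t : K, R (x₁ + s • y₂) (y₁ + t • x₂) := by
    intro s hs
    obtain h | ⟨t, h⟩ := hR.meet (x₁ + s • y₂) y₁ x₂
    · exact absurd (hR.symm (cancel hs (hR.symm (subr (by rw [add_comm]; exact hR.symm h)
        (hR.symm hx))))) h22
    · exact ⟨t, h⟩
  choose! g hg0 hg using hg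
  choose! k hk0 hk using hk
  choose! h hh using hh
  -- the perp of `x₁ + y₁ + a x₂ + g b y₂` contains five explicit vectors of a `4`-space
  -- but not `x₁`, which yields two relations between `g`, `h` and `k`
  have key : ∀ a b : K, a ≠ 0 → b ≠ 0 → g a / k a = h (g b) / b ∧
      1 + g a / k a - a / b - g b / k a = 0 := by
    intro a b ha hb
    set p : V := x₁ + y₁ + a • x₂ + g b • y₂ with hp
    have hk0 := hk0 a ha
    have hpx : x₁ ∉ hR.perp p := by
      intro hc
      have h1 : R x₁ (y₁ + (x₁ + a • x₂ + g b • y₂)) := by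
        rw [show y₁ + (x₁ + a • x₂ + g b • y₂) = p by rw [hp]; abel]; exact hR.symm hc
      exact h11 (subr h1 (hR.add (hR.add (hR.refl _) (hR.smul a hx)) (hR.smul _ h12)))
    have hA : x₁ + b • x₂ ∈ hR.perp p := by
      refine hR.symm ?_
      rw [show p = (y₁ + g b • y₂) + (x₁ + a • x₂) by rw [hp]; abel]
      exact hR.add (hg b hb) (hR.add (addl (hR.refl _) (smull b (hR.symm hx)))
        (hR.smul a (addl hx (smull b (hR.refl _)))))
    have hB : x₁ + k a • y₂ ∈ hR.perp p := by
      refine hR.symm ?_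
      rw [show p = (y₁ + a • x₂) + (x₁ + g b • y₂) by rw [hp]; abel]
      exact hR.add (hR.symm (hk a ha)) (hR.add (addl (hR.refl _) (smull _ (hR.symm h12)))
        (hR.smul _ (addl h12 (smull _ (hR.refl _)))))
    have hC : y₁ + g a • y₂ ∈ hR.perp p := by
      refine hR.symm ?_
      rw [show p = (x₁ + a • x₂) + (y₁ + g b • y₂) by rw [hp]; abel]
      exact hR.add (hR.symm (hg a ha)) (hR.add (addl (hR.refl _) (smull _ (hR.symm hy)))
        (hR.smul _ (addl hy (smull _ (hR.refl _)))))
    have hD : y₁ + h (g b) • x₂ ∈ hR.perp p := by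
      refine hR.symm ?_
      rw [show p = (x₁ + g b • y₂) + (y₁ + a • x₂) by rw [hp]; abel]
      exact hR.add (hR.symm (hh _ (hg0 b hb))) (hR.add (addl (hR.refl _) (smull _ h21))
        (hR.smul _ (addl (hR.symm h21) (smull _ (hR.refl _)))))
    have hP : p ∈ hR.perp p := hR.refl p
    have coef : ∀ c : K, c • x₁ ∈ hR.perp p → c = 0 := fun c hc => by
      by_contra h0
      exact hpx (by simpa [smul_smul, inv_mul_cancel₀ h0] using (hR.perp p).smul_mem c⁻¹ hc)
    have hCB := (hR.perp p).sub_mem hC ((hR.perp p).smul_mem (g a / k a) hB)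
    constructor
    · have hDA := (hR.perp p).sub_mem hD ((hR.perp p).smul_mem (h (g b) / b) hA)
      have := coef (g a / k a - h (g b) / b) (by
        convert (hR.perp p).sub_mem hDA hCB using 1
        match_scalars <;> field_simp <;> ring)
      linear_combination this
    · refine coef _ ?_
      convert (hR.perp p).sub_mem ((hR.perp p).sub_mem ((hR.perp p).sub_mem hP hCB)
        ((hR.perp p).smul_mem (a / b) hA)) ((hR.perp p).smul_mem (g b / k a) hB) using 1
      rw [hp]
      match_scalars <;> field_simp <;> ring
  -- exchanging `a` and `b` in the second relation shows that `k` is inversely proportional to `a`;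
  -- by the first relation `g` is proportional to `k`
  have hsymm : ∀ a b : K, a ≠ 0 → b ≠ 0 → a * k a = b * k b := by
    intro a b ha hb
    obtain rfl | hab := eq_or_ne a b
    · rfl
    have h1 := (key a b ha hb).2
    have h2 := (key b a hb ha).2
    have hka := hk0 a ha
    have hkb := hk0 b hb
    field_simp at h1 h2
    have h3 : (a - b) * (a * k a - b * k b) = 0 := by linear_combination (-a) * h1 - b * h2
    have := (mul_eq_zero.1 h3).resolve_left (sub_ne_zero.2 hab)
    linear_combination this
  have h1 := hk0 1 one_ne_zero
  refine ⟨g 1, hg0 1 one_ne_zero, fun s hs => ?_⟩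
  have hs' := hk0 s hs
  have e : g 1 / s = g s := by
    have e1 := (key s 1 hs one_ne_zero).1.trans (key 1 1 one_ne_zero one_ne_zero).1.symm
    have e2 := hsymm s 1 hs one_ne_zero
    field_simp at e1 ⊢
    have : k 1 * (g 1 - g s * s) = 0 := by linear_combination (-s) * e1 - g 1 * e2
    have := (mul_eq_zero.1 this).resolve_left h1
    linear_combination this
  rw [e]
  exact hg s hs

/-- A null relation is given by a bilinear pairing on `L × V`, for every totally isotropic line
`L` disjoint from the radical. The functionals with kernels the perps of `x₁` and `x₂` can be scaled
independently; the hyperbolic ratio fixes the scaling that is right for all combinations. -/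
theorem exists_pairing {x₁ x₂ : V} (hx : R x₁ x₂)
    (hrad : ∀ a b : K, a ≠ 0 ∨ b ≠ 0 → hR.perp (a • x₁ + b • x₂) ≠ ⊤) :
    ∃ f₁ f₂ : V →ₗ[K] K, ∀ a b : K, a ≠ 0 ∨ b ≠ 0 → ∀ v,
      v ∈ hR.perp (a • x₁ + b • x₂) ↔ a * f₁ v + b * f₂ v = 0 := by
  obtain ⟨y₂, h12, h22⟩ := SetLike.not_le_iff_exists.1 (hR.not_perp_le_of_forall_ne_top hrad)
  obtain ⟨y₁, h21, h11⟩ := SetLike.not_le_iff_exists.1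
    (hR.not_perp_le_of_forall_ne_top (x := x₂) (y := x₁) fun a b hab => by
      rw [add_comm]; exact hrad b a hab.symm)
  -- `y₂` may be moved along `x₁` to make it related to `y₁`
  obtain ⟨y₂, h12, h22, hy⟩ : ∃ y, y ∈ hR.perp x₁ ∧ y ∉ hR.perp x₂ ∧ R y₁ y := by
    obtain h | ⟨s, h⟩ := hR.meet y₁ y₂ x₁
    · exact absurd (hR.symm h) h11
    · refine ⟨y₂ + s • x₁, hR.add h12 (hR.smul s (hR.refl _)), fun hc => h22 ?_, h⟩
      simpa using (hR.perp x₂).sub_mem hc (hR.smul s (hR.symm hx))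
  obtain ⟨γ, hγ, hr⟩ := hR.exists_hyperbolic_ratio h11 h22 hx h12 h21 hy
  -- `f₂ y₂ = -1 / γ` makes `f₁ + s f₂` vanish at `y₁ + (γ / s) y₂`, as `x₁ + s x₂` requires
  obtain ⟨f₁, hf₁, hk₁⟩ := hR.exists_functional h11 one_ne_zero
  obtain ⟨f₂, hf₂, hk₂⟩ := hR.exists_functional h22 (neg_ne_zero.2 (inv_ne_zero hγ))
  have h21' := (hk₂ _).1 h21
  have h12' := (hk₁ _).1 h12
  have scale : ∀ {c : K} (_ : c ≠ 0) (x v : V), v ∈ hR.perp (c • x) ↔ v ∈ hR.perp x := by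
    intro c hc x v
    rw [hR.mem_perp_comm, hR.mem_perp_comm (x := x), Submodule.smul_mem_iff _ hc]
  refine ⟨f₁, f₂, fun a b hab v => ?_⟩
  obtain rfl | hb := eq_or_ne b 0
  · have ha : a ≠ 0 := by simpa using hab
    simp [scale ha, hk₁, ha]
  obtain rfl | ha := eq_or_ne a 0
  · simp [scale hb, hk₂, hb]
  have hker : ∀ v, a * f₁ v + b * f₂ v = 0 → v ∈ hR.perp (a • x₁ + b • x₂) := by
    intro v hv
    have hu : v - f₁ v • (y₁ + (γ / (b / a)) • y₂) ∈ hR.perp (a • x₁ + b • x₂) := by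
      refine hR.mem_perp_smul_add_smul ((hk₁ _).2 ?_) ((hk₂ _).2 ?_) a b
      · simp [hf₁, h12']
      · simp only [map_sub, map_smul, map_add, hf₂, h21', smul_eq_mul]
        field_simp
        linear_combination hv
    have hz : y₁ + (γ / (b / a)) • y₂ ∈ hR.perp (a • x₁ + b • x₂) := by
      have := hr (b / a) (div_ne_zero hb ha)
      rw [← hR.mem_perp, ← scale ha, smul_add, smul_smul, mul_div_cancel₀ _ ha] at this
      exact this
    simpa using (hR.perp _).add_mem hu ((hR.perp _).smul_mem (f₁ v) hz)
  refine ⟨fun hv => ?_, hker v⟩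
  by_contra hne
  refine hrad a b hab (eq_top_iff.2 fun u _ => ?_)
  have := hker (u - ((a * f₁ u + b * f₂ u) / (a * f₁ v + b * f₂ v)) • v) (by
    simp only [map_sub, map_smul, smul_eq_mul]
    field_simp
    ring)
  simpa using (hR.perp _).add_mem this ((hR.perp _).smul_mem
    ((a * f₁ u + b * f₂ u) / (a * f₁ v + b * f₂ v)) hv)

end IsNullRelation

end NullRelation

/-! ### Residues of hyperplanes -/

section Residue

open Submodule

variable {K V : Type*} [Field K] [AddCommGroup V] [Module K V]

theorem mem_sup_span_singleton_exchange {B : Submodule K V} {x y : V}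
    (hy : y ∈ B ⊔ span K {x}) (hyB : y ∉ B) : x ∈ B ⊔ span K {y} := by
  obtain ⟨u, hu, c, rfl⟩ : ∃ u ∈ B, ∃ c : K, u + c • x = y := by
    simpa [mem_sup, mem_span_singleton] using hy
  have hc : c ≠ 0 := by rintro rfl; simp [hu] at hyB
  have h := mem_sup_right (S := B) (mem_span_singleton_self (R := K) (u + c • x))
  have h2 := smul_mem _ c⁻¹ (sub_mem h (mem_sup_left (T := span K {u + c • x}) hu))
  simpa [smul_smul, inv_mul_cancel₀ hc] using h2

variable [FiniteDimensional K V]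

theorem eq_sup_span_singleton {k : ℕ} {Y X : Submodule K V} {x : V} (hYX : Y ≤ X)
    (hY : Module.finrank K Y + 1 = k) (hX : Module.finrank K X = k) (hx : x ∈ X) (hxY : x ∉ Y) :
    Y ⊔ span K {x} = X := by
  refine eq_of_le_of_finrank_eq (sup_le hYX ((span_singleton_le_iff_mem _ _).2 hx)) ?_
  rw [finrank_sup_span_singleton hxY, hY, hX]

/-- For a set `H` of `k`-subspaces and a `(k-2)`-subspace `B`, the relation that `x` and `y` are
dependent modulo `B` or span, together with `B`, a member of `H`. -/
def residueRel (H : Set (Submodule K V)) (B : Submodule K V) (x y : V) : Prop :=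
  x ∈ B ∨ y ∈ B ⊔ span K {x} ∨ B ⊔ span K {x} ⊔ span K {y} ∈ H

variable {k : ℕ} {H : Set (Submodule K V)}

/-- The vectors that lie in a `(k-1)`-subspace `Y` or span with it a member of a geometric subspace
are closed under addition: `Y + ⟨y⟩` and `Y + ⟨z⟩` lie on a line through `Y + ⟨y + z⟩`. -/
theorem IsGeomSubspace.mem_star_add (hS : IsGeomSubspace k H) {Y : Submodule K V}
    (hY : Module.finrank K Y + 1 = k) {y z : V}
    (hy : y ∈ Y ∨ Y ⊔ span K {y} ∈ H) (hz : z ∈ Y ∨ Y ⊔ span K {z} ∈ H) :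
    y + z ∈ Y ∨ Y ⊔ span K {y + z} ∈ H := by
  by_cases hyz : y + z ∈ Y
  · exact Or.inl hyz
  right
  have hself : ∀ v : V, v ∈ Y ⊔ span K {v} := fun v =>
    mem_sup_right (mem_span_singleton_self v)
  have hdim : ∀ v : V, v ∉ Y → Module.finrank K (Y ⊔ span K {v} : Submodule K V) = k :=
    fun v hv => by rw [finrank_sup_span_singleton hv, hY]
  have heq : ∀ v : V, v ∉ Y → y + z ∈ Y ⊔ span K {v} → Y ⊔ span K {y + z} = Y ⊔ span K {v} :=
    fun v hv h => eq_sup_span_singleton le_sup_left hY (hdim v hv) h hyz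
  by_cases hyY : y ∈ Y
  · have hzY : z ∉ Y := fun h => hyz (add_mem hyY h)
    rw [heq z hzY (add_mem (mem_sup_left hyY) (hself z))]
    exact hz.resolve_left hzY
  by_cases hzY : z ∈ Y
  · rw [heq y hyY (add_mem (hself y) (mem_sup_left hzY))]
    exact hy.resolve_left hyY
  replace hy := hy.resolve_left hyY
  replace hz := hz.resolve_left hzY
  by_cases hzy : z ∈ Y ⊔ span K {y}
  · rw [heq y hyY (add_mem (hself y) hzy)]
    exact hy
  have hYZ : Y < Y ⊔ span K {y} ⊔ span K {z} :=
    lt_of_le_of_ne (le_sup_left.trans le_sup_left) fun h => hyY (h ▸ mem_sup_left (hself y))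
  have hzZ : z ∈ Y ⊔ span K {y} ⊔ span K {z} := mem_sup_right (mem_span_singleton_self z)
  refine hS.2 _ ⟨Y, _, hYZ, hY, ?_, rfl⟩ ⟨_, ⟨⟨hdim y hyY, le_sup_left, le_sup_left⟩, hy⟩, _,
    ⟨⟨hdim z hzY, le_sup_left, sup_le hYZ.le ((span_singleton_le_iff_mem _ _).2 hzZ)⟩, hz⟩,
    fun h => hzy (h ▸ hself z)⟩ ⟨hdim _ hyz, le_sup_left, sup_le hYZ.le
      ((span_singleton_le_iff_mem _ _).2 (add_mem (mem_sup_left (hself y)) hzZ))⟩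
  rw [finrank_sup_span_singleton hzy, hdim y hyY]

/-- If `H` meets every line, the members of `H` on a `(k-1)`-subspace `Y` have codimension at most
`1` among the `k`-subspaces on `Y`. -/
theorem exists_add_smul_mem_star
    (hm : ∀ l : Set (Submodule K V), IsLine k l → (l ∩ H).Nonempty) {Y : Submodule K V}
    (hY : Module.finrank K Y + 1 = k) (y z : V) :
    (z ∈ Y ∨ Y ⊔ span K {z} ∈ H) ∨
      ∃ s : K, y + s • z ∈ Y ∨ Y ⊔ span K {y + s • z} ∈ H := by
  by_cases hzY : z ∈ Y
  · exact Or.inl (Or.inl hzY)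
  by_cases hyz : y ∈ Y ⊔ span K {z}
  · obtain ⟨u, hu, c, rfl⟩ : ∃ u ∈ Y, ∃ c : K, u + c • z = y := by
      simpa [mem_sup, mem_span_singleton] using hyz
    exact Or.inr ⟨-c, Or.inl (by simpa using hu)⟩
  have hYZ : Y < Y ⊔ span K {z} ⊔ span K {y} :=
    lt_of_le_of_ne (le_sup_left.trans le_sup_left) fun h =>
      hzY (h ▸ mem_sup_left (mem_sup_right (mem_span_singleton_self z)))
  obtain ⟨X, ⟨hX, hYX, hXZ⟩, hXH⟩ := hm _ ⟨Y, _, hYZ, hY, by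
    rw [finrank_sup_span_singleton hyz, finrank_sup_span_singleton hzY, hY], rfl⟩
  have hX : Module.finrank K X = k := hX
  obtain ⟨x, hxX, hxY⟩ : ∃ x ∈ X, x ∉ Y := by
    refine SetLike.not_le_iff_exists.1 fun h => ?_
    have := finrank_mono h
    omega
  obtain ⟨u, hu, c, d, rfl⟩ : ∃ u ∈ Y, ∃ c d : K, u + c • z + d • y = x := by
    have := hXZ hxX
    simp only [mem_sup, mem_span_singleton] at this
    obtain ⟨_, ⟨u, hu, _, ⟨c, rfl⟩, rfl⟩, _, ⟨d, rfl⟩, rfl⟩ := this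
    exact ⟨u, hu, c, d, rfl⟩
  have huX := hYX hu
  by_cases hd : d = 0
  · subst hd
    have hc : c ≠ 0 := by rintro rfl; simp [hu] at hxY
    refine Or.inl (Or.inr ?_)
    rw [eq_sup_span_singleton hYX hY hX _ hzY]
    · exact hXH
    · simpa [smul_smul, inv_mul_cancel₀ hc] using X.smul_mem c⁻¹ (X.sub_mem hxX huX)
  · refine Or.inr ⟨c / d, Or.inr ?_⟩
    rw [eq_sup_span_singleton hYX hY hX]
    · exact hXH
    · convert X.smul_mem d⁻¹ (X.sub_mem hxX huX) using 1
      match_scalars <;> field_simp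
      ring
    · intro h
      apply hyz
      have h2 := sub_mem (mem_sup_left (T := span K {z}) h)
        (smul_mem _ (c / d) (mem_sup_right (S := Y) (mem_span_singleton_self (R := K) z)))
      simpa using h2

/-- The members of a hyperplane containing a `(k-2)`-subspace form a null polarity. -/
theorem IsGeomSubspace.isNullRelation_residueRel (hS : IsGeomSubspace k H)
    (hm : ∀ l : Set (Submodule K V), IsLine k l → (l ∩ H).Nonempty) {B : Submodule K V}
    (hB : Module.finrank K B + 2 = k) : IsNullRelation K (residueRel H B) where
  refl x := Or.inr (Or.inl (mem_sup_right (mem_span_singleton_self x)))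
  symm {x y} h := by
    by_cases hy : y ∈ B
    · exact Or.inl hy
    refine Or.inr ?_
    obtain h | h | h := h
    · exact Or.inl (mem_sup_left h)
    · exact Or.inl (mem_sup_span_singleton_exchange h hy)
    · right; rwa [sup_right_comm]
  add {x y z} h h' := by
    by_cases hx : x ∈ B
    · exact Or.inl hx
    exact Or.inr (hS.mem_star_add (by rw [finrank_sup_span_singleton hx]; omega)
      (h.resolve_left hx) (h'.resolve_left hx))
  smul c {x y} h := by
    obtain rfl | hc := eq_or_ne c 0
    · exact Or.inr (Or.inl (by simp))
    · simpa [residueRel, smul_mem_iff _ hc, span_singleton_smul_eq hc.isUnit] using h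
  meet x y z := by
    by_cases hx : x ∈ B
    · exact Or.inl (Or.inl hx)
    obtain h | ⟨s, h⟩ := exists_add_smul_mem_star hm (Y := B ⊔ span K {x})
      (by rw [finrank_sup_span_singleton hx]; omega) y z
    · exact Or.inl (Or.inr h)
    · exact Or.inr ⟨s, Or.inr h⟩

end Residue

/-! ### Hyperplanes in dimension five -/

section Duality

open Submodule Module

variable {K V : Type*} [Field K] [AddCommGroup V] [Module K V] [FiniteDimensional K V]

theorem exists_mem_notMem_of_finrank_lt {S T : Submodule K V} (h : finrank K S < finrank K T) :
    ∃ x ∈ T, x ∉ S :=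
  SetLike.not_le_iff_exists.1 fun hle => (finrank_mono hle).not_gt h

theorem exists_pair_of_finrank_eq_two {L : Submodule K V} (hL : finrank K L = 2) :
    ∃ x y : V, span K {x} ⊔ span K {y} = L ∧ ∀ a b : K, a ≠ 0 ∨ b ≠ 0 → a • x + b • y ≠ 0 := by
  obtain ⟨x, hxL, hx⟩ := exists_mem_notMem_of_finrank_lt (S := ⊥) (T := L) (by simp [hL])
  rw [mem_bot] at hx
  have h1 := finrank_span_singleton (K := K) hx
  obtain ⟨y, hyL, hy⟩ := exists_mem_notMem_of_finrank_lt (S := span K {x}) (T := L) (by omega)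
  refine ⟨x, y, eq_sup_span_singleton ((span_singleton_le_iff_mem _ _).2 hxL) (by omega) hL hyL hy,
    fun a b hab h => ?_⟩
  obtain rfl | hb := eq_or_ne b 0
  · simp_all
  · refine hy (mem_span_singleton.2 ⟨-(a / b), ?_⟩)
    rw [← inv_smul_smul₀ hb y, eq_neg_of_add_eq_zero_right h]
    simp [div_eq_inv_mul, smul_smul]

variable {k j : ℕ} {H : Set (Submodule K V)}

/-- The set of `j`-subspaces of the dual space corresponding to `H`, where `j` is the codimension
of the members of `H`. -/
def dualSet (j : ℕ) (H : Set (Submodule K V)) : Set (Submodule K (Dual K V)) :=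
  {Φ | finrank K Φ = j ∧ Φ.dualCoannihilator ∈ H}

theorem finrank_dualCoannihilator_of_add_eq (hV : finrank K V = k + j)
    {Φ : Submodule K (Dual K V)} {i : ℕ} (h : finrank K Φ + i = k + j) :
    finrank K Φ.dualCoannihilator = i := by
  have := Subspace.finrank_add_finrank_dualCoannihilator_eq Φ
  omega

/-- Coannihilators carry the line between `Y` and `Z` of the dual Grassmannian to the line between
the coannihilators of `Z` and `Y`. -/
theorem isLine_dualCoannihilator (hV : finrank K V = k + j) {Y Z : Submodule K (Dual K V)}
    (hYZ : Y < Z) (hY : finrank K Y + 1 = j) (hZ : finrank K Z = j + 1) :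
    IsLine k (pencil k Z.dualCoannihilator Y.dualCoannihilator) := by
  have h := Subspace.finrank_add_finrank_dualCoannihilator_eq Z
  have hZ' : finrank K Z.dualCoannihilator + 1 = k := by omega
  have hY' : finrank K Y.dualCoannihilator = k + 1 :=
    finrank_dualCoannihilator_of_add_eq hV (by omega)
  refine ⟨_, _, lt_of_le_of_ne (dualCoannihilator_anti hYZ.le) fun h => ?_, hZ', hY', rfl⟩
  rw [h] at hZ'
  omega

theorem IsGeomSubspace.dualSet (hV : finrank K V = k + j) (hS : IsGeomSubspace k H) :
    IsGeomSubspace j (dualSet j H) := by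
  refine ⟨fun Φ h => h.1, ?_⟩
  rintro _ ⟨Y, Z, hYZ, hY, hZ, rfl⟩ ⟨Φ, ⟨⟨hΦ, hYΦ, hΦZ⟩, -, hΦH⟩, Ψ, ⟨⟨hΨ, hYΨ, hΨZ⟩, -, hΨH⟩,
    hne⟩ X ⟨hX, hYX, hXZ⟩
  have hdim : ∀ {Φ : Submodule K (Dual K V)}, Φ ∈ points K (Dual K V) j →
      Φ.dualCoannihilator ∈ points K V k := fun {Φ} (hΦ : finrank K Φ = j) =>
    finrank_dualCoannihilator_of_add_eq hV (by omega)
  refine ⟨hX, hS.2 _ (isLine_dualCoannihilator hV hYZ hY hZ) ⟨_, ⟨⟨hdim hΦ,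
    dualCoannihilator_anti hΦZ, dualCoannihilator_anti hYΦ⟩, hΦH⟩, _, ⟨⟨hdim hΨ,
    dualCoannihilator_anti hΨZ, dualCoannihilator_anti hYΨ⟩, hΨH⟩, fun h => hne ?_⟩ ⟨hdim hX,
    dualCoannihilator_anti hXZ, dualCoannihilator_anti hYX⟩⟩
  rw [← Subspace.dualCoannihilator_dualAnnihilator_eq (W := Φ), h,
    Subspace.dualCoannihilator_dualAnnihilator_eq]

theorem dualSet_meets_line (hV : finrank K V = k + j)
    (hm : ∀ l : Set (Submodule K V), IsLine k l → (l ∩ H).Nonempty)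
    (l : Set (Submodule K (Dual K V))) (hl : IsLine j l) : (l ∩ dualSet j H).Nonempty := by
  obtain ⟨Y, Z, hYZ, hY, hZ, rfl⟩ := hl
  obtain ⟨X, ⟨hX, hZX, hXY⟩, hXH⟩ := hm _ (isLine_dualCoannihilator hV hYZ hY hZ)
  have hX : finrank K X = k := hX
  have hj : finrank K X.dualAnnihilator = j := by
    have := Subspace.finrank_add_finrank_dualAnnihilator_eq X
    omega
  refine ⟨X.dualAnnihilator, ⟨hj, le_dualAnnihilator_iff_le_dualCoannihilator.2 hXY, ?_⟩, hj, ?_⟩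
  · rw [← Subspace.dualCoannihilator_dualAnnihilator_eq (W := Z)]
    exact dualAnnihilator_anti hZX
  · rwa [Subspace.dualAnnihilator_dualCoannihilator_eq]

theorem IsNullRelation.finrank_le_finrank_perp_inf_perp_add_two {R : V → V → Prop}
    (hR : IsNullRelation K R) (x y : V) :
    finrank K V ≤ finrank K (hR.perp x ⊓ hR.perp y : Submodule K V) + 2 := by
  have h1 := hR.finrank_le_finrank_perp_add_one x
  have h2 := hR.finrank_le_finrank_perp_add_one y
  have h3 := finrank_sup_add_finrank_inf_eq (hR.perp x) (hR.perp y)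
  have h4 := finrank_le (hR.perp x ⊔ hR.perp y)
  omega

/-- In dimension at least `5` a null relation has a totally isotropic plane. -/
theorem IsNullRelation.exists_isotropic_plane {R : V → V → Prop} (hR : IsNullRelation K R)
    (hV : 5 ≤ finrank K V) :
    ∃ Φ : Submodule K V, finrank K Φ = 3 ∧ ∀ u ∈ Φ, ∀ v ∈ Φ, R u v := by
  obtain ⟨x, -, hx⟩ := exists_mem_notMem_of_finrank_lt (S := (⊥ : Submodule K V)) (T := ⊤)
    (by rw [finrank_bot, finrank_top]; omega)
  rw [mem_bot] at hx
  have h1 := finrank_span_singleton (K := K) hx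
  obtain ⟨y, hyx, hy⟩ := exists_mem_notMem_of_finrank_lt (S := span K {x}) (T := hR.perp x)
    (by have := hR.finrank_le_finrank_perp_add_one x; omega)
  have h2 := finrank_sup_span_singleton hy
  obtain ⟨z, ⟨hzx, hzy⟩, hz⟩ := exists_mem_notMem_of_finrank_lt (S := span K {x} ⊔ span K {y})
    (T := hR.perp x ⊓ hR.perp y)
    (by have := hR.finrank_le_finrank_perp_inf_perp_add_two x y; omega)
  have h3 := finrank_sup_span_singleton hz
  refine ⟨_, by rw [h3, h2, h1], fun u hu v hv => ?_⟩
  have hle : ∀ w, x ∈ hR.perp w → y ∈ hR.perp w → z ∈ hR.perp w →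
      span K {x} ⊔ span K {y} ⊔ span K {z} ≤ hR.perp w := fun w h h' h'' => by
    simp only [sup_le_iff, span_singleton_le_iff_mem]
    exact ⟨⟨h, h'⟩, h''⟩
  exact hle u (hR.symm (hle x (hR.refl x) hyx hzx hu)) (hR.symm (hle y (hR.symm hyx) (hR.refl y)
    hzy hu)) (hR.symm (hle z (hR.symm hzx) (hR.symm hzy) (hR.refl z) hu)) hv

/-- In dimension `5` the hyperplane is, dually, a null relation on the `5`-dimensional dual
space, and a totally isotropic plane of it is the annihilator of a member of the upper radical. -/
theorem IsHyperplane.upperRadical_nonempty (hV : finrank K V = 5) (hH : IsHyperplane 3 H) :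
    (upperRadical 3 H).Nonempty := by
  have hR := (hH.1.dualSet (j := 2) (by omega)).isNullRelation_residueRel
    (dualSet_meets_line (by omega) hH.2.2) (B := ⊥) (by simp)
  obtain ⟨Φ, hΦ, hiso⟩ := hR.exists_isotropic_plane (by rw [Subspace.dual_finrank_eq, hV])
  have hdim := Subspace.finrank_add_finrank_dualCoannihilator_eq Φ
  refine ⟨Φ.dualCoannihilator, by omega, fun X hX hle => ?_⟩
  have hX : finrank K X = 3 := hX
  have hann := Subspace.finrank_add_finrank_dualAnnihilator_eq X
  obtain ⟨u, v, huv, hind⟩ := exists_pair_of_finrank_eq_two (L := X.dualAnnihilator) (by omega)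
  have hΦX : X.dualAnnihilator ≤ Φ := by
    rw [← Subspace.dualCoannihilator_dualAnnihilator_eq (W := Φ)]
    exact dualAnnihilator_anti hle
  have hu : u ∈ X.dualAnnihilator := huv ▸ mem_sup_left (mem_span_singleton_self u)
  have hv : v ∈ X.dualAnnihilator := huv ▸ mem_sup_right (mem_span_singleton_self v)
  obtain h | h | h := hiso u (hΦX hu) v (hΦX hv)
  · exact absurd (by simpa using h) (hind 1 0 (by simp))
  · obtain ⟨c, rfl⟩ := mem_span_singleton.1 (by simpa using h)
    exact absurd (by simp) (hind (-c) 1 (by simp))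
  · rw [bot_sup_eq, huv] at h
    rw [← Subspace.dualAnnihilator_dualCoannihilator_eq (W := X)]
    exact h.2

end Duality

/-! ### Spread upper radicals -/

section SpreadRadical

open Submodule Module

variable {K V : Type*} [Field K] [AddCommGroup V] [Module K V]

/-- Every `2 × 2` matrix over a quadratically closed field has an eigenvector. -/
theorem IsQuadraticallyClosed.exists_eigenvector (hK : IsQuadraticallyClosed K) (a b c d : K) :
    ∃ x y t : K, (x ≠ 0 ∨ y ≠ 0) ∧ x * a + y * c = t * x ∧ x * b + y * d = t * y := by
  obtain rfl | hc := eq_or_ne c 0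
  · exact ⟨0, 1, d, by simp, by simp, by simp⟩
  obtain ⟨t, ht⟩ := hK (.X ^ 2 - .C (a + d) * .X + .C (a * d - b * c)) (by compute_degree!)
  simp only [Polynomial.IsRoot.def, Polynomial.eval_add, Polynomial.eval_sub, Polynomial.eval_mul,
    Polynomial.eval_pow, Polynomial.eval_X, Polynomial.eval_C] at ht
  exact ⟨c, t - a, t, Or.inl hc, by ring, by linear_combination -ht⟩

theorem IsLineSpread.eq_of_mem {S : Set (Submodule K V)} (hS : IsLineSpread S)
    {L M : Submodule K V} (hL : L ∈ S) (hM : M ∈ S) {x : V} (hx : x ≠ 0) (hxL : x ∈ L)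
    (hxM : x ∈ M) : L = M :=
  (hS.2 (span K {x}) (finrank_span_singleton hx)).unique
    ⟨hL, (span_singleton_le_iff_mem _ _).2 hxL⟩ ⟨hM, (span_singleton_le_iff_mem _ _).2 hxM⟩

theorem IsLineSpread.exists_mem {S : Set (Submodule K V)} (hS : IsLineSpread S) {x : V}
    (hx : x ≠ 0) : ∃ L ∈ S, x ∈ L := by
  obtain ⟨L, ⟨hL, hxL⟩, -⟩ := hS.2 (span K {x}) (finrank_span_singleton hx)
  exact ⟨L, hL, (span_singleton_le_iff_mem _ _).1 hxL⟩

variable [FiniteDimensional K V] {H : Set (Submodule K V)}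

theorem residueRel_of_mem_upperRadical {A : Submodule K V} (hA : A ∈ upperRadical 3 H)
    {m l v : V} (hm : m ≠ 0) (hle : A ≤ span K {m} ⊔ span K {l} ⊔ span K {v}) :
    residueRel H (span K {m}) l v := by
  by_cases hl : l ∈ span K {m}
  · exact Or.inl hl
  by_cases hv : v ∈ span K {m} ⊔ span K {l}
  · exact Or.inr (Or.inl hv)
  refine Or.inr (Or.inr (hA.2 _ ?_ hle))
  change finrank K _ = 3
  rw [finrank_sup_span_singleton hv, finrank_sup_span_singleton hl, finrank_span_singleton hm]

theorem mem_upperRadical_of_forall_residueRel {m l : V} (hm : m ≠ 0) (hl : l ∉ span K {m})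
    (h : ∀ v, residueRel H (span K {m}) l v) :
    span K {m} ⊔ span K {l} ∈ upperRadical 3 H := by
  have hdim : finrank K (span K {m} ⊔ span K {l} : Submodule K V) + 1 = 3 := by
    rw [finrank_sup_span_singleton hl, finrank_span_singleton hm]
  refine ⟨hdim, fun X hX hle => ?_⟩
  have hX : finrank K X = 3 := hX
  obtain ⟨v, hvX, hv⟩ := exists_mem_notMem_of_finrank_lt
    (S := span K {m} ⊔ span K {l}) (T := X) (by omega)
  rw [← eq_sup_span_singleton hle hdim hX hvX hv]
  exact ((h v).resolve_left hl).resolve_left hv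

/-- Two members `L`, `M` of the spread and the members of `H` meeting both behave like a bilinear
map `L × M → K²` without zero divisors. For two vectors `m₁`, `m₂` of `M` this yields a
`2 × 2` matrix, and an eigenvector of it would be a zero divisor. -/
theorem IsHyperplane.not_isQuadraticallyClosed (hV : finrank K V = 6) (hH : IsHyperplane 3 H)
    (hspread : IsLineSpread (upperRadical 3 H)) : ¬ IsQuadraticallyClosed K := by
  intro hK
  obtain ⟨v, -, hv⟩ := exists_mem_notMem_of_finrank_lt (S := (⊥ : Submodule K V)) (T := ⊤)
    (by rw [finrank_bot, finrank_top]; omega)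
  rw [mem_bot] at hv
  obtain ⟨L, hL, -⟩ := hspread.exists_mem hv
  have hLdim : finrank K L = 2 := hspread.1 hL
  obtain ⟨w, -, hw⟩ := exists_mem_notMem_of_finrank_lt (S := L) (T := ⊤)
    (by rw [finrank_top]; omega)
  obtain ⟨M, hM, hwM⟩ := hspread.exists_mem (x := w) (by rintro rfl; exact hw L.zero_mem)
  have hMdim : finrank K M = 2 := hspread.1 hM
  have hdisj : ∀ x, x ∈ L → x ∈ M → x = 0 := fun x hxL hxM => by
    by_contra hx
    exact hw (hspread.eq_of_mem hL hM hx hxL hxM ▸ hwM)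
  obtain ⟨l₁, l₂, hl, hlind⟩ := exists_pair_of_finrank_eq_two hLdim
  obtain ⟨m₁, m₂, hm, hmind⟩ := exists_pair_of_finrank_eq_two hMdim
  have hl₁ : l₁ ∈ L := hl ▸ mem_sup_left (mem_span_singleton_self l₁)
  have hl₂ : l₂ ∈ L := hl ▸ mem_sup_right (mem_span_singleton_self l₂)
  have hm₁ : m₁ ∈ M := hm ▸ mem_sup_left (mem_span_singleton_self m₁)
  have hm₂ : m₂ ∈ M := hm ▸ mem_sup_right (mem_span_singleton_self m₂)
  have hm₁0 : m₁ ≠ 0 := by simpa using hmind 1 0 (by simp)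
  have hm₂0 : m₂ ≠ 0 := by simpa using hmind 0 1 (by simp)
  have hlcomb : ∀ a b : K, a • l₁ + b • l₂ ∈ L := fun a b =>
    L.add_mem (L.smul_mem a hl₁) (L.smul_mem b hl₂)
  have hmcomb : ∀ a b : K, a • m₁ + b • m₂ ∈ M := fun a b =>
    M.add_mem (M.smul_mem a hm₁) (M.smul_mem b hm₂)
  have hlM : ∀ l ∈ L, l ≠ 0 → ∀ m ∈ M, l ∉ span K {m} := fun l hl hl0 m hm h =>
    hl0 (hdisj l hl ((span_singleton_le_iff_mem _ _).2 hm h))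
  have hmL : ∀ m ∈ M, m ≠ 0 → ∀ l ∈ L, m ∉ span K {l} := fun m hm hm0 l hl h =>
    hm0 (hdisj m ((span_singleton_le_iff_mem _ _).2 hl h) hm)
  have hnull : ∀ {x : V}, x ≠ 0 → IsNullRelation K (residueRel H (span K {x})) := fun hx =>
    hH.1.isNullRelation_residueRel hH.2.2 (by rw [finrank_span_singleton hx])
  -- a line meeting both `L` and `M` is not in the upper radical
  have hnondeg : ∀ (m : V) (hm : m ∈ M) (hm0 : m ≠ 0) (l : V) (_ : l ∈ L) (_ : l ≠ 0),
      (hnull hm0).perp l ≠ ⊤ := by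
    intro m hm hm0 l hl hl0 h
    have hA := mem_upperRadical_of_forall_residueRel hm0 (hlM l hl hl0 m hm) fun v =>
      (hnull hm0).mem_perp.1 (h ▸ mem_top)
    have := hspread.eq_of_mem hA hL hl0 (mem_sup_right (mem_span_singleton_self l)) hl
    exact hm0 (hdisj m (this ▸ mem_sup_left (mem_span_singleton_self m)) hm)
  -- the pairing of `L` with `V` relative to `m`, together with the vanishing on `L + M`
  have hpair : ∀ (m : V) (hm : m ∈ M) (hm0 : m ≠ 0), ∃ f₁ f₂ : Dual K V,
      (∀ a b : K, a ≠ 0 ∨ b ≠ 0 → ∀ v,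
        v ∈ (hnull hm0).perp (a • l₁ + b • l₂) ↔ a * f₁ v + b * f₂ v = 0) ∧
      f₁ ∈ (L ⊔ M).dualAnnihilator ∧ f₂ ∈ (L ⊔ M).dualAnnihilator := by
    intro m hmM hm0
    have hl₁₂ : residueRel H (span K {m}) l₁ l₂ :=
      residueRel_of_mem_upperRadical hL hm0 (by rw [sup_assoc, hl]; exact le_sup_right)
    obtain ⟨f₁, f₂, hf⟩ := (hnull hm0).exists_pairing hl₁₂ fun a b hab =>
      hnondeg m hmM hm0 _ (hlcomb a b) (hlind a b hab)
    have hM' : ∀ l, M ≤ (hnull hm0).perp l := fun l x hx => by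
      by_cases hxm : x ∈ span K {m}
      · exact Or.inr (Or.inl (mem_sup_left hxm))
      · refine residueRel_of_mem_upperRadical hM hm0 ?_
        rw [sup_right_comm, eq_sup_span_singleton ((span_singleton_le_iff_mem _ _).2 hmM)
          (by rw [finrank_span_singleton hm0]) hMdim hx hxm]
        exact le_sup_left
    have hL' : ∀ a b : K, L ≤ (hnull hm0).perp (a • l₁ + b • l₂) := fun a b => by
      rw [← hl, sup_le_iff, span_singleton_le_iff_mem, span_singleton_le_iff_mem]
      exact ⟨(hnull hm0).mem_perp_smul_add_smul ((hnull hm0).refl _) ((hnull hm0).symm hl₁₂) a b,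
        (hnull hm0).mem_perp_smul_add_smul hl₁₂ ((hnull hm0).refl _) a b⟩
    refine ⟨f₁, f₂, hf, (mem_dualAnnihilator _).2 fun x hx => ?_,
      (mem_dualAnnihilator _).2 fun x hx => ?_⟩
    · simpa using (hf 1 0 (by simp) x).1 (sup_le (hL' 1 0) (hM' _) hx)
    · simpa using (hf 0 1 (by simp) x).1 (sup_le (hL' 0 1) (hM' _) hx)
  obtain ⟨f₁, f₂, hf, hf₁, hf₂⟩ := hpair m₁ hm₁ hm₁0
  obtain ⟨g₁, g₂, hg, hg₁, hg₂⟩ := hpair m₂ hm₂ hm₂0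
  have hfne : ∀ a b : K, a ≠ 0 ∨ b ≠ 0 → a • f₁ + b • f₂ ≠ 0 := by
    intro a b hab h
    refine hnondeg m₁ hm₁ hm₁0 _ (hlcomb a b) (hlind a b hab) (eq_top_iff.2 fun v _ => ?_)
    exact (hf a b hab v).2 (by simpa using LinearMap.congr_fun h v)
  have hann : finrank K (L ⊔ M).dualAnnihilator = 2 := by
    have h1 := Subspace.finrank_add_finrank_dualAnnihilator_eq (L ⊔ M)
    have h2 := finrank_sup_add_finrank_inf_eq L M
    rw [show L ⊓ M = ⊥ from (Submodule.eq_bot_iff _).2 fun x hx => hdisj x hx.1 hx.2,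
      finrank_bot] at h2
    omega
  have hf₁0 : f₁ ≠ 0 := by simpa using hfne 1 0 (by simp)
  have hspan : span K {f₁} ⊔ span K {f₂} = (L ⊔ M).dualAnnihilator := by
    refine eq_sup_span_singleton ((span_singleton_le_iff_mem _ _).2 hf₁)
      (by rw [finrank_span_singleton hf₁0]) hann hf₂ fun h => ?_
    obtain ⟨c, rfl⟩ := mem_span_singleton.1 h
    exact hfne (-c) 1 (by simp) (LinearMap.ext fun v => by simp)
  have hexp : ∀ g ∈ (L ⊔ M).dualAnnihilator, ∃ a b : K, a • f₁ + b • f₂ = g := fun g hg => by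
    rw [← hspan] at hg
    simpa [mem_sup, mem_span_singleton] using hg
  obtain ⟨a, b, rfl⟩ := hexp g₁ hg₁
  obtain ⟨c, d, rfl⟩ := hexp g₂ hg₂
  obtain ⟨x, y, t, hxy, h1, h2⟩ := hK.exists_eigenvector a b c d
  have hgt : ∀ v, x * (a • f₁ + b • f₂) v + y * (c • f₁ + d • f₂) v =
      t * (x * f₁ v + y * f₂ v) := fun v => by
    simp only [LinearMap.add_apply, LinearMap.smul_apply, smul_eq_mul]
    linear_combination f₁ v * h1 + f₂ v * h2
  set l := x • l₁ + y • l₂ with hldef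
  have hlL : l ∈ L := hlcomb x y
  have hl0 : l ≠ 0 := hlind x y hxy
  have hswap : ∀ (m : V) (hm : m ∈ M) (hm0 : m ≠ 0),
      (hnull hl0).perp m = (hnull hm0).perp l := by
    intro m hm hm0
    ext v
    simp only [IsNullRelation.mem_perp, residueRel, hmL m hm hm0 l hlL, hlM l hlL hl0 m hm,
      false_or, sup_comm (span K {m})]
  refine (hnull hl0).not_perp_le_of_forall_ne_top (x := m₁) (y := m₂) (fun a b hab => ?_) ?_
  · rw [hswap _ (hmcomb a b) (hmind a b hab)]
    exact hnondeg _ (hmcomb a b) (hmind a b hab) l hlL hl0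
  · rw [hswap m₁ hm₁ hm₁0, hswap m₂ hm₂ hm₂0]
    intro v hv
    rw [hldef, hf x y hxy] at hv
    rw [hldef, hg x y hxy, hgt, hv, mul_zero]

end SpreadRadical

/-! ### Hyperplanes from alternating forms and from quadratic extensions -/

section FormHyperplane

open Submodule Module

variable {K V : Type*} [Field K] [AddCommGroup V] [Module K V]

/-- The `3`-subspaces of `V` that are totally isotropic for the alternating form `ω`. -/
def formHyperplane (ω : V [⋀^Fin 3]→ₗ[K] K) : Set (Submodule K V) :=
  {X | finrank K X = 3 ∧ ∀ x : Fin 3 → V, (∀ i, x i ∈ X) → ω x = 0}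

/-- The linear functional `v ↦ ω(v, a, b)`. -/
def contraction (ω : V [⋀^Fin 3]→ₗ[K] K) (a b : V) : V →ₗ[K] K where
  toFun v := ω ![v, a, b]
  map_add' v w := ω.map_vecCons_add ![a, b] v w
  map_smul' c v := ω.map_vecCons_smul ![a, b] c v

variable {ω : V [⋀^Fin 3]→ₗ[K] K}

theorem span_sup_span_le_ker_contraction (a b : V) :
    span K {a} ⊔ span K {b} ≤ LinearMap.ker (contraction ω a b) := by
  rw [sup_le_iff, span_singleton_le_iff_mem, span_singleton_le_iff_mem]
  exact ⟨ω.map_eq_zero_of_eq (i := 0) (j := 1) _ rfl (by decide),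
    ω.map_eq_zero_of_eq (i := 0) (j := 2) _ rfl (by decide)⟩

theorem span_range_mem_formHyperplane {x : Fin 3 → V}
    (hx : finrank K (span K (Set.range x)) = 3) (h : ω x = 0) :
    span K (Set.range x) ∈ formHyperplane ω := by
  refine ⟨hx, fun y hy => ?_⟩
  have hli : LinearIndependent K x := linearIndependent_iff_card_eq_finrank_span.2 (by
    rw [Set.finrank, hx, Fintype.card_fin])
  have h0 : ω.compLinearMap (span K (Set.range x)).subtype = 0 := by
    rw [← AlternatingMap.map_basis_eq_zero_iff (Basis.span hli)]
    simpa [Basis.span_apply, Function.comp_def] using h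
  simpa using DFunLike.congr_fun h0 fun i => (⟨y i, hy i⟩ : span K (Set.range x))

variable [FiniteDimensional K V]

/-- On the `3`-subspaces through `⟨a, b⟩`, membership in the hyperplane is the vanishing of one
functional. -/
theorem mem_formHyperplane_iff {X : Submodule K V} {a b : V} (hX : finrank K X = 3)
    (hle : span K {a} ⊔ span K {b} ≤ X)
    (hab : finrank K (span K {a} ⊔ span K {b} : Submodule K V) = 2) :
    X ∈ formHyperplane ω ↔ X ≤ LinearMap.ker (contraction ω a b) := by
  have haX := hle (mem_sup_left (mem_span_singleton_self a))
  have hbX := hle (mem_sup_right (mem_span_singleton_self b))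
  constructor
  · intro h v hv
    refine h.2 _ fun i => ?_
    fin_cases i
    exacts [hv, haX, hbX]
  · intro h
    obtain ⟨v, hvX, hv⟩ := exists_mem_notMem_of_finrank_lt (S := span K {a} ⊔ span K {b})
      (T := X) (by omega)
    have hspan : span K (Set.range ![v, a, b]) = X := by
      rw [← eq_sup_span_singleton hle (by rw [hab]) hX hvX hv, sup_comm, ← span_union,
        ← span_union]
      simp only [Matrix.range_cons, Matrix.range_empty, Set.union_empty]
    rw [← hspan]
    exact span_range_mem_formHyperplane (by rw [hspan, hX]) (h hvX)

theorem isHyperplane_formHyperplane (hω : ω ≠ 0) : IsHyperplane 3 (formHyperplane ω) := by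
  refine ⟨⟨fun X hX => hX.1, ?_⟩, fun h => ?_, ?_⟩
  · rintro _ ⟨Y, Z, -, hY, hZ, rfl⟩ ⟨X₁, ⟨⟨hX₁, hYX₁, hXZ₁⟩, hH₁⟩, X₂, ⟨⟨hX₂, hYX₂, hXZ₂⟩, hH₂⟩,
      hne⟩ X ⟨hX, hYX, hXZ⟩
    have hX₁ : finrank K X₁ = 3 := hX₁
    have hX₂ : finrank K X₂ = 3 := hX₂
    obtain ⟨a, b, rfl, -⟩ := exists_pair_of_finrank_eq_two (L := Y) (by omega)
    rw [mem_formHyperplane_iff ‹_› ‹_› (by omega)] at hH₁ hH₂ ⊢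
    have hlt : X₁ < X₁ ⊔ X₂ := lt_of_le_of_ne le_sup_left fun h =>
      hne (eq_of_le_of_finrank_eq (h ▸ le_sup_right) (by rw [hX₁, hX₂])).symm
    have := finrank_lt_finrank_of_lt hlt
    have hsup := eq_of_le_of_finrank_le (sup_le hXZ₁ hXZ₂) (by omega)
    exact hXZ.trans (hsup ▸ sup_le hH₁ hH₂)
  · obtain ⟨x, hx⟩ : ∃ x, ω x ≠ 0 := by
      by_contra! hc
      exact hω (AlternatingMap.ext hc)
    have hli : LinearIndependent K x := by
      by_contra hc
      exact hx (ω.map_linearDependent x hc)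
    have hmem : span K (Set.range x) ∈ formHyperplane ω := by
      rw [h]
      exact (finrank_span_eq_card hli).trans (Fintype.card_fin 3)
    exact hx (hmem.2 x fun i => subset_span (Set.mem_range_self i))
  · rintro _ ⟨Y, Z, hYZ, hY, hZ, rfl⟩
    obtain ⟨a, b, rfl, -⟩ := exists_pair_of_finrank_eq_two (L := Y) (by omega)
    set φ := contraction ω a b
    have h1 := φ.finrank_range_add_finrank_ker
    have h2 := finrank_le (LinearMap.range φ)
    have h3 := finrank_sup_add_finrank_inf_eq Z (LinearMap.ker φ)
    have h4 := finrank_le (Z ⊔ LinearMap.ker φ)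
    rw [finrank_self] at h2
    obtain ⟨v, ⟨hvZ, hvφ⟩, hv⟩ := exists_mem_notMem_of_finrank_lt
      (S := span K {a} ⊔ span K {b}) (T := Z ⊓ LinearMap.ker φ) (by omega)
    have hdim : finrank K (span K {a} ⊔ span K {b} ⊔ span K {v} : Submodule K V) = 3 := by
      rw [finrank_sup_span_singleton hv]
      omega
    refine ⟨_, ⟨hdim, le_sup_left, sup_le hYZ.le ((span_singleton_le_iff_mem _ _).2 hvZ)⟩,
      (mem_formHyperplane_iff hdim le_sup_left (by omega)).2 (sup_le ?_ ?_)⟩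
    · exact span_sup_span_le_ker_contraction a b
    · exact (span_singleton_le_iff_mem _ _).2 hvφ

theorem span_sup_span_mem_upperRadical_formHyperplane_iff {a b : V}
    (hab : finrank K (span K {a} ⊔ span K {b} : Submodule K V) = 2) :
    span K {a} ⊔ span K {b} ∈ upperRadical 3 (formHyperplane ω) ↔ ∀ v, ω ![v, a, b] = 0 := by
  constructor
  · intro h v
    by_cases hv : v ∈ span K {a} ⊔ span K {b}
    · exact span_sup_span_le_ker_contraction a b hv
    have hdim : finrank K (span K {a} ⊔ span K {b} ⊔ span K {v} : Submodule K V) = 3 := by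
      rw [finrank_sup_span_singleton hv, hab]
    exact (mem_formHyperplane_iff hdim le_sup_left hab).1 (h.2 _ hdim le_sup_left)
      (mem_sup_right (mem_span_singleton_self v))
  · exact fun h => ⟨by rw [hab], fun X hX hle =>
      (mem_formHyperplane_iff hX hle hab).2 fun v _ => h v⟩

end FormHyperplane

section QuadraticExtension

open Submodule Module

variable {K V : Type*} [Field K] [AddCommGroup V] [Module K V]

theorem exists_quadratic_extension.{u} {K : Type u} [Field K]
    (hK : ¬ IsQuadraticallyClosed K) :
    ∃ (F : Type u) (_ : Field F) (_ : Algebra K F), finrank K F = 2 := by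
  simp only [IsQuadraticallyClosed, not_forall, not_exists] at hK
  obtain ⟨p, hp, hroot⟩ := hK
  have hirr : Irreducible p := (Polynomial.irreducible_iff_roots_eq_zero_of_degree_le_three
    hp.ge (by omega)).2 (Multiset.eq_zero_of_forall_notMem fun x hx =>
      hroot x (Polynomial.isRoot_of_mem_roots hx))
  have := Fact.mk hirr
  exact ⟨AdjoinRoot p, inferInstance, inferInstance, by
    rw [(AdjoinRoot.powerBasis hirr.ne_zero).finrank, AdjoinRoot.powerBasis_dim, hp]⟩

variable {F : Type*} [Field F] [Algebra K F]

/-- The `K`-trilinear form `θ ∘ det` on `V`, where `V` is identified with `F³` by `e`. -/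
noncomputable def detForm (e : V ≃ₗ[K] (Fin 3 → F)) (θ : F →ₗ[K] K) : V [⋀^Fin 3]→ₗ[K] K :=
  (θ.compAlternatingMap
    { toMultilinearMap := Matrix.detRowAlternating.toMultilinearMap.restrictScalars K
      map_eq_zero_of_eq' := Matrix.detRowAlternating.map_eq_zero_of_eq' }).compLinearMap
    e.toLinearMap

theorem detForm_apply (e : V ≃ₗ[K] (Fin 3 → F)) (θ : F →ₗ[K] K) (x : Fin 3 → V) :
    detForm e θ x = θ (Matrix.det (Matrix.of fun i => e (x i))) := rfl

theorem exists_detForm_ne_zero (e : V ≃ₗ[K] (Fin 3 → F)) {θ : F →ₗ[K] K} (hθ : θ ≠ 0) {a b : V}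
    (hab : LinearIndependent F ![e a, e b]) : ∃ v, detForm e θ ![v, a, b] ≠ 0 := by
  obtain ⟨c, hc⟩ := exists_linearIndependent_cons_of_lt_finrank hab (by simp)
  have hdet : Matrix.det (Matrix.of ![c, e a, e b]) ≠ 0 :=
    ((Matrix.isUnit_iff_isUnit_det _).1 (Matrix.linearIndependent_rows_iff_isUnit.1 hc)).ne_zero
  obtain ⟨z, hz⟩ : ∃ z, θ z ≠ 0 := by
    by_contra! h
    exact hθ (LinearMap.ext h)
  refine ⟨e.symm ((z / Matrix.det (Matrix.of ![c, e a, e b])) • c), ?_⟩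
  rw [detForm_apply]
  convert hz
  have h := Matrix.detRowAlternating.map_vecCons_smul (R := F) ![e a, e b]
    (z / Matrix.det (Matrix.of ![c, e a, e b])) c
  rw [smul_eq_mul] at h
  refine Eq.trans ?_ (h.trans (div_mul_cancel₀ z hdet))
  congr 1
  ext i
  fin_cases i <;> simp

theorem detForm_eq_zero (e : V ≃ₗ[K] (Fin 3 → F)) (θ : F →ₗ[K] K) {a b : V} {z : F}
    (h : e b = z • e a) (v : V) : detForm e θ ![v, a, b] = 0 := by
  have : ¬ LinearIndependent F fun i => e (![v, a, b] i) := fun hli => by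
    have := Fintype.linearIndependent_iff.1 hli ![0, z, -1] (by simp [Fin.sum_univ_three, h]) 2
    simp at this
  rw [detForm_apply]
  exact (congrArg θ (Matrix.detRowAlternating.map_linearDependent _ this)).trans θ.map_zero

/-- The one-dimensional `F`-subspace through `x`, as a `K`-subspace. -/
def scalarLine (e : V ≃ₗ[K] (Fin 3 → F)) (x : V) : Submodule K V :=
  LinearMap.range (e.symm.toLinearMap ∘ₗ (LinearMap.toSpanSingleton F _ (e x)).restrictScalars K)

theorem mem_scalarLine {e : V ≃ₗ[K] (Fin 3 → F)} {x y : V} :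
    y ∈ scalarLine e x ↔ ∃ z : F, e y = z • e x := by
  simp only [scalarLine, LinearMap.mem_range, LinearMap.comp_apply, LinearEquiv.coe_coe,
    LinearEquiv.symm_apply_eq]
  exact exists_congr fun z => eq_comm

theorem finrank_scalarLine (e : V ≃ₗ[K] (Fin 3 → F)) {x : V} (hx : x ≠ 0) :
    finrank K (scalarLine e x) = finrank K F := by
  refine LinearMap.finrank_range_of_inj (e.symm.injective.comp ?_)
  exact smul_left_injective F (e.map_ne_zero_iff.2 hx)

/-- The upper radical of the hyperplane of `θ ∘ det` consists of the one-dimensional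
`F`-subspaces. -/
theorem isLineSpread_upperRadical_detForm [FiniteDimensional K V] (hF : finrank K F = 2)
    (e : V ≃ₗ[K] (Fin 3 → F)) {θ : F →ₗ[K] K} (hθ : θ ≠ 0) :
    IsLineSpread (upperRadical 3 (formHyperplane (detForm e θ))) := by
  refine ⟨fun A hA => Nat.succ_injective hA.1, fun P hP => ?_⟩
  obtain ⟨x, hx, rfl⟩ : ∃ x, x ≠ 0 ∧ span K {x} = P := by
    obtain ⟨x, hxP, hx⟩ := exists_mem_notMem_of_finrank_lt (S := ⊥) (T := P) (by
      rw [show finrank K P = 1 from hP]; simp)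
    rw [mem_bot] at hx
    exact ⟨x, hx, eq_of_le_of_finrank_eq ((span_singleton_le_iff_mem _ _).2 hxP)
      ((finrank_span_singleton hx).trans (Eq.symm hP))⟩
  have hx1 := finrank_span_singleton (K := K) hx
  have hL : finrank K (scalarLine e x) = 2 := (finrank_scalarLine e hx).trans hF
  have hxL : span K {x} ≤ scalarLine e x :=
    (span_singleton_le_iff_mem _ _).2 (mem_scalarLine.2 ⟨1, by simp⟩)
  refine ⟨scalarLine e x, ⟨?_, hxL⟩, fun A ⟨hA, hxA⟩ => ?_⟩
  · obtain ⟨y, hyL, hy⟩ := exists_mem_notMem_of_finrank_lt (S := span K {x})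
      (T := scalarLine e x) (by omega)
    have hxy := eq_sup_span_singleton hxL (by omega) hL hyL hy
    obtain ⟨z, hz⟩ := mem_scalarLine.1 hyL
    rw [← hxy, span_sup_span_mem_upperRadical_formHyperplane_iff (by rw [hxy, hL])]
    exact detForm_eq_zero e θ hz
  · have hA2 : finrank K A = 2 := Nat.succ_injective hA.1
    refine eq_of_le_of_finrank_eq (fun y hyA => ?_) (hA2.trans hL.symm)
    by_contra hyL
    have hxy := eq_sup_span_singleton hxA (by omega) hA2 hyA fun h => hyL (hxL h)
    rw [← hxy, span_sup_span_mem_upperRadical_formHyperplane_iff (by rw [hxy, hA2])] at hA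
    obtain ⟨v, hv⟩ := exists_detForm_ne_zero e hθ (a := x) (b := y)
      ((LinearIndependent.pair_iff' (e.map_ne_zero_iff.2 hx)).2 fun z hz =>
        hyL (mem_scalarLine.2 ⟨z, hz.symm⟩))
    exact hv (hA v)

theorem exists_isHyperplane_isLineSpread_of_extension (hV : finrank K V = 6)
    (hF : finrank K F = 2) :
    ∃ H : Set (Submodule K V), IsHyperplane 3 H ∧ IsLineSpread (upperRadical 3 H) := by
  have : FiniteDimensional K V := FiniteDimensional.of_finrank_pos (by omega)
  have : FiniteDimensional K F := FiniteDimensional.of_finrank_pos (by omega)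
  let e : V ≃ₗ[K] (Fin 3 → F) := LinearEquiv.ofFinrankEq _ _ (by
    rw [hV, Module.finrank_pi_fintype]; simp [hF])
  obtain ⟨θ, hθ⟩ := Module.Projective.exists_dual_ne_zero K (one_ne_zero (α := F))
  have hθ : θ ≠ 0 := by rintro rfl; exact hθ rfl
  refine ⟨_, isHyperplane_formHyperplane fun h => ?_, isLineSpread_upperRadical_detForm hF e hθ⟩
  obtain ⟨v, hv⟩ := exists_detForm_ne_zero e hθ (a := e.symm (Pi.single 0 1))
    (b := e.symm (Pi.single 1 1)) (by
      refine Fintype.linearIndependent_iff.2 fun g hg => ?_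
      have h0 := congrFun hg 0
      have h1 := congrFun hg 1
      intro i
      fin_cases i <;> simp_all [Fin.sum_univ_two])
  exact hv (by rw [h]; rfl)

end QuadraticExtension

end GrassmannHyperplane

theorem mainTheorem4 (K : Type*) [Field K] (V : Type*) [AddCommGroup V] [Module K V] :
    (Module.finrank K V = 5 →
      ∀ H : Set (Submodule K V), GrassmannHyperplane.IsHyperplane 3 H →
        (GrassmannHyperplane.upperRadical 3 H).Nonempty) ∧
    (Module.finrank K V = 6 →
      ((∃ H : Set (Submodule K V), GrassmannHyperplane.IsHyperplane 3 H ∧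
          GrassmannHyperplane.IsLineSpread (GrassmannHyperplane.upperRadical 3 H)) ↔
        ¬ GrassmannHyperplane.IsQuadraticallyClosed K)) := by
  refine ⟨fun hV H hH => ?_, fun hV => ⟨?_, ?_⟩⟩
  · have : FiniteDimensional K V := FiniteDimensional.of_finrank_pos (by omega)
    exact hH.upperRadical_nonempty hV
  · rintro ⟨H, hH, hspread⟩
    have : FiniteDimensional K V := FiniteDimensional.of_finrank_pos (by omega)
    exact hH.not_isQuadraticallyClosed hV hspread
  · intro hK
    obtain ⟨F, _, _, hF⟩ := GrassmannHyperplane.exists_quadratic_extension hK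
    exact GrassmannHyperplane.exists_isHyperplane_isLineSpread_of_extension hV hF
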